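/- Fix $L\ge 1$ and $K\ge 2$, and write $\|x\|^2=\frac1L\sum_i x_i^2$ on $\mathbb R^L$. Let $\Lambda_c\subset\mathbb R^L$ be a (full-rank) central lattice of a fixed shape, i.e. geometrically similar to a fixed lattice $\Lambda$ (its fundamental volume $\nu$ is arbitrary and may vary with $N$). Let $\Lambda_s\subseteq\Lambda_c$ be a sublattice geometrically similar to $\Lambda_c$ of index $N=[\Lambda_c:\Lambda_s]$, let $\Lambda_\pi\subseteq\Lambda_s$ be a product lattice with $[\Lambda_s:\Lambda_\pi]=N$, and let $V_\pi(0)$ be the Voronoi cell of $\Lambda_\pi$ around the origin, with ties on its boundary broken, so that it contains exactly one point of each class of $\Lambda_c$ modulo $\Lambda_\pi$ ($N^2$ points of $\Lambda_c$ in all). A labeling function is an injective map $\alpha=(\alpha_0,\dots,\alpha_{K-1}):\Lambda_c\to\Lambda_s^K$ with $\alpha(\lambda_c+\lambda_\pi)=\alpha(\lambda_c)+\lambda_\pi$ for all $\lambda_\pi\in\Lambda_\pi$; write $\lambda_i=\alpha_i(\lambda_c)$. Let $0<p<1$ be the packet-loss probability, and let $\alpha$ be an optimal labeling function: either it minimizes,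 over all labeling functions, the cost functional $$\sum_{\kappa=1}^{K-1}\frac{(1-p)^{\kappa}p^{K-\kappa}}{N^2}\sum_{l\subseteq\{0,\dots,K-1\},\,|l|=\kappa}\ \sum_{\lambda_c\in V_\pi(0)}\Big\|\lambda_c-\frac1\kappa\sum_{j\in l}\lambda_j\Big\|^2 ,$$ or it minimizes $\sum_{\lambda_c\in V_\pi(0)}\sum_{i<j}\|\lambda_i-\lambda_j\|^2$ and, among the labeling functions that do so, minimizes $\sum_{\lambda_c\in V_\pi(0)}\|\lambda_c-\frac1K\sum_{i}\lambda_i\|^2$. Then, as $N\to\infty$ with $K$, $L$ and $\Lambda$ fixed (uniformly in $\nu$, $p$ and all other choices above), the sum $\sum_{\lambda_c\in V_\pi(0)}\sum_{i<j}\|\lambda_i-\lambda_j\|^2$ is eventually positive, $$\frac{\sum_{\lambda_c\in V_\pi(0)}\big\|\lambda_c-\frac1K\sum_{i=0}^{K-1}\lambda_i\big\|^2}{\sum_{\lambda_c\in V_\pi(0)}\sum_{i=0}^{K-2}\sum_{j=i+1}^{K-1}\|\lambda_i-\lambda_j\|^2}\longrightarrow 0,$$ and this ratio is $O\big(N^{-2/(L(K-1))}\big)$.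 Hence the pairwise-distance term dominates the expected distortion: for every $1\le\kappa<K$, the ratio of $$(1-p)^\kappa p^{K-\kappa}\binom K\kappa\frac1{N^2}\,\frac{K-\kappa}{K^2\kappa(K-1)}\sum_{\lambda_c\in V_\pi(0)}\sum_{i<j}\|\lambda_i-\lambda_j\|^2$$ to the high-resolution expected distortion $$(1-p)^\kappa p^{K-\kappa}\Big(\binom K\kappa d_c+\frac1{N^2}\sum_{|l|=\kappa}\ \sum_{\lambda_c\in V_\pi(0)}\Big\|\lambda_c-\frac1\kappa\sum_{j\in l}\lambda_j\Big\|^2\Big),\qquad d_c=G(\Lambda_c)\,\nu^{2/L},$$ tends to $1$, where $G(\Lambda_c)=\nu^{-1-2/L}\int_{V_c(0)}\|x\|^2\,dx$ and $V_c(0)$ is the Voronoi cell of $\Lambda_c$ around the origin. -/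

import Mathlib

open Filter Topology MeasureTheory Asymptotics

namespace MDLVQ

/-- `L`-dimensional Euclidean space. -/
abbrev E (L : ℕ) : Type := EuclideanSpace ℝ (Fin L)

/-- The squared `l₂`-norm normalized per dimension, `‖x‖² = (1/L) ∑ xᵢ²`. -/
noncomputable def sqNorm {L : ℕ} (x : E L) : ℝ := (∑ i, x i ^ 2) / L

/-- `Λ'` is geometrically similar to `Λ`: it is obtained from `Λ` by a change of scale and
an orthogonal transformation. -/
def IsSimilar {L : ℕ} (Λ Λ' : Submodule ℤ (E L)) : Prop :=
  ∃ c : ℝ, 0 < c ∧ ∃ U : E L ≃ₗᵢ[ℝ] E L, (Λ' : Set (E L)) = (fun x => c • U x) '' (Λ : Set (E L))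

/-- The (closed) Voronoi cell of the lattice `Λ` around `v`. -/
def voronoiCell {L : ℕ} (Λ : Submodule ℤ (E L)) (v : E L) : Set (E L) :=
  {x | ∀ w ∈ Λ, sqNorm (x - v) ≤ sqNorm (x - w)}

/-- The finite set `V` consists of the points of `Λc` in the Voronoi cell of `Λp` around the
origin, where ties on the boundary of the cell are broken (in an arbitrary way) so that the
translates of the cell by `Λp` do not overlap: each class of `Λc` modulo `Λp` has exactly one
representative in `V`. -/
structure IsVoronoiLabelSet {L : ℕ} (Λc Λp : Submodule ℤ (E L)) (V : Finset (E L)) : Prop where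
  mem_lattice : ∀ v ∈ V, v ∈ Λc
  mem_cell : ∀ v ∈ V, v ∈ voronoiCell Λp 0
  existsUnique_rep : ∀ x ∈ Λc, ∃! v, v ∈ V ∧ x - v ∈ Λp

/-- The index `[Λ : Λ']` of a sublattice `Λ'` of `Λ`. -/
noncomputable def latticeIndex {L : ℕ} (Λ Λ' : Submodule ℤ (E L)) : ℕ :=
  Λ'.toAddSubgroup.relIndex Λ.toAddSubgroup

/-- A labeling function with `K` components: it maps `Λc` injectively into `Λs × ⋯ × Λs` and is
invariant under shifts by `Λp`. (Only its values on `Λc` matter.) -/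
structure IsLabeling {L K : ℕ} (Λc Λs Λp : Submodule ℤ (E L)) (α : E L → Fin K → E L) :
    Prop where
  mem : ∀ x ∈ Λc, ∀ i, α x i ∈ Λs
  injOn : Set.InjOn α (Λc : Set (E L))
  shift : ∀ x ∈ Λc, ∀ y ∈ Λp, ∀ i, α (x + y) i = α x i + y

/-- Sum over `V` of the squared distances of the central points to the centroids of their
`K`-tuples. -/
noncomputable def centroidSum {L K : ℕ} (V : Finset (E L)) (α : E L → Fin K → E L) : ℝ :=
  ∑ x ∈ V, sqNorm (x - (1 / (K : ℝ)) • ∑ i, α x i)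

/-- Sum over `V` of the sums of pairwise squared distances (SPSD) of the `K`-tuples. -/
noncomputable def spsdSum {L K : ℕ} (V : Finset (E L)) (α : E L → Fin K → E L) : ℝ :=
  ∑ x ∈ V, ∑ i, ∑ j ∈ Finset.Ioi i, sqNorm (α x i - α x j)

/-- Sum, over all sets `l` of `κ` received descriptions and over `V`, of the squared distances of
the central points to the averages of the received descriptions. -/
noncomputable def receptionSum {L K : ℕ} (κ : ℕ) (V : Finset (E L)) (α : E L → Fin K → E L) : ℝ :=
  ∑ l ∈ Finset.powersetCard κ (Finset.univ : Finset (Fin K)), ∑ x ∈ V,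
    sqNorm (x - (1 / (κ : ℝ)) • ∑ j ∈ l, α x j)

/-- The cost functional `∑_{κ=1}^{K-1} J^{(K,κ)}` of an index assignment, for packet-loss
probability `p` and index `N`. -/
noncomputable def cost {L K : ℕ} (p : ℝ) (N : ℕ) (V : Finset (E L)) (α : E L → Fin K → E L) : ℝ :=
  ∑ κ ∈ Finset.Icc 1 (K - 1),
    ((1 - p) ^ κ * p ^ (K - κ) / (N : ℝ) ^ 2) * receptionSum κ V α

/-- `α` minimizes the cost functional among all labeling functions. -/
def IsCostOptimal {L K : ℕ} (Λc Λs Λp : Submodule ℤ (E L)) (p : ℝ) (N : ℕ) (V : Finset (E L))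
    (α : E L → Fin K → E L) : Prop :=
  ∀ β : E L → Fin K → E L, IsLabeling Λc Λs Λp β → cost p N V α ≤ cost p N V β

/-- `α` uses `K`-tuples with the lowest SPSD and, among the labeling functions that do so, it
minimizes the sum of the squared distances to the centroids. -/
def IsSPSDOptimal {L K : ℕ} (Λc Λs Λp : Submodule ℤ (E L)) (V : Finset (E L))
    (α : E L → Fin K → E L) : Prop :=
  ∀ β : E L → Fin K → E L, IsLabeling Λc Λs Λp β →
    spsdSum V α ≤ spsdSum V β ∧ (spsdSum V β = spsdSum V α → centroidSum V α ≤ centroidSum V β)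

/-- A balanced multiple-description lattice vector quantizer with `K` descriptions and an optimal
index assignment, whose central lattice is geometrically similar to the given lattice `Λ`. -/
structure OptimalQuantizer {L : ℕ} (Λ : Submodule ℤ (E L)) (K : ℕ) where
  /-- the central lattice -/
  Λc : Submodule ℤ (E L)
  /-- the sublattice of the side quantizers -/
  Λs : Submodule ℤ (E L)
  /-- the product lattice -/
  Λp : Submodule ℤ (E L)
  /-- the index of the sublattice -/
  N : ℕ
  /-- the central lattice points in the Voronoi cell of the product lattice around the origin -/
  V : Finset (E L)
  /-- the packet-loss probability -/
  p : ℝ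
  /-- the labeling function -/
  α : E L → Fin K → E L
  central_similar : IsSimilar Λ Λc
  side_le : Λs ≤ Λc
  side_similar : IsSimilar Λc Λs
  side_index : latticeIndex Λc Λs = N
  product_le : Λp ≤ Λs
  product_index : latticeIndex Λs Λp = N
  N_pos : 0 < N
  isVoronoiLabelSet : IsVoronoiLabelSet Λc Λp V
  p_pos : 0 < p
  p_lt_one : p < 1
  isLabeling : IsLabeling Λc Λs Λp α
  optimal : IsCostOptimal Λc Λs Λp p N V α ∨ IsSPSDOptimal Λc Λs Λp V α

/-- The dimensionless normalized second moment of inertia `G(Λ)` of a lattice. -/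
noncomputable def normalizedSecondMoment {L : ℕ} (Λ : Submodule ℤ (E L)) : ℝ :=
  1 / ZLattice.covolume Λ volume ^ (1 + 2 / (L : ℝ)) * ∫ x in voronoiCell Λ 0, sqNorm x

/-- The central distortion at high resolution, `G(Λ) ν^{2/L}`. -/
noncomputable def centralDistortion {L : ℕ} (Λ : Submodule ℤ (E L)) : ℝ :=
  normalizedSecondMoment Λ * ZLattice.covolume Λ volume ^ (2 / (L : ℝ))

namespace OptimalQuantizer

/-- The high-resolution expression for the expected distortion due to the reception of `κ` out of
`K` descriptions, `1 ≤ κ < K`. -/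
noncomputable def expectedDistortion {L K : ℕ} {Λ : Submodule ℤ (E L)} (Q : OptimalQuantizer Λ K)
    (κ : ℕ) : ℝ :=
  (1 - Q.p) ^ κ * Q.p ^ (K - κ) *
    ((K.choose κ : ℝ) * centralDistortion Q.Λc + 1 / (Q.N : ℝ) ^ 2 * receptionSum κ Q.V Q.α)

/-- The part of the expected distortion that comes from the pairwise distances between the elements
of the `K`-tuples. -/
noncomputable def pairwiseDistortion {L K : ℕ} {Λ : Submodule ℤ (E L)} (Q : OptimalQuantizer Λ K)
    (κ : ℕ) : ℝ :=
  (1 - Q.p) ^ κ * Q.p ^ (K - κ) * (K.choose κ : ℝ) *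
    (1 / (Q.N : ℝ) ^ 2 * (((K : ℝ) - κ) / ((K : ℝ) ^ 2 * κ * ((K : ℝ) - 1)) * spsdSum Q.V Q.α))

/-- The filter `N → ∞` on quantizers. -/
def highResolution {L : ℕ} (Λ : Submodule ℤ (E L)) (K : ℕ) : Filter (OptimalQuantizer Λ K) :=
  comap OptimalQuantizer.N atTop

end OptimalQuantizer

end MDLVQ

/-! An averaging identity (`receptionSum_eq`) writes the distortion over all sets of κ descriptions
as a binomial coefficient times (centroid sum + constant · SPSD sum). Hence, under either optimality
criterion, any competing labeling with no larger SPSD bounds the centroid sum of the optimal one.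

To build a competitor, record the shape of a tuple, its differences from one fixed component. Shift
invariance and injectivity let each shape occur at most N times on the N² points of V
(`card_filter_shape_le`), so N cheapest shapes, each used N times, cost no more than the given
labeling. Assign these shapes bijectively to the cosets of Λs in Λc and translate each by a vector
of Λs that brings its centroid near the point to be labeled (`exists_labeling_of_shapes`). The
centroid sum is then O(N² r²), with r a covering radius of Λs.

Conversely, tuples of small SPSD are scarce: a shape has K - 1 free components in Λs, so counting
lattice points in a ball forces SPSD of order r² N^(2/(L(K-1))) on at least half of V
(`le_spsdSum`). Dividing gives the rate. The central distortion is also O(r²), and the scale of the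
lattices cancels, which makes the bounds uniform. -/

namespace MDLVQ

/-! ### Splitting the distortion into centroid and pairwise terms -/

/-- The sum of pairwise squared distances of a `K`-tuple. -/
noncomputable def spsd {L K : ℕ} (t : Fin K → E L) : ℝ :=
  ∑ i, ∑ j ∈ Finset.Ioi i, sqNorm (t i - t j)

/-- The squared distance of `x` to the centroid of a `K`-tuple. -/
noncomputable def centroidSq {L K : ℕ} (x : E L) (t : Fin K → E L) : ℝ :=
  sqNorm (x - (1 / (K : ℝ)) • ∑ i, t i)

lemma sqNorm_eq {L : ℕ} (x : E L) : sqNorm x = ‖x‖ ^ 2 / L := by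
  rw [sqNorm, EuclideanSpace.real_norm_sq_eq]

lemma sqNorm_nonneg {L : ℕ} (x : E L) : 0 ≤ sqNorm x := by
  rw [sqNorm_eq]; positivity

lemma spsd_nonneg {L K : ℕ} (t : Fin K → E L) : 0 ≤ spsd t :=
  Finset.sum_nonneg fun _ _ => Finset.sum_nonneg fun _ _ => sqNorm_nonneg _

lemma centroidSum_nonneg {L K : ℕ} (V : Finset (E L)) (α : E L → Fin K → E L) :
    0 ≤ centroidSum V α :=
  Finset.sum_nonneg fun _ _ => sqNorm_nonneg _

lemma card_filter_powersetCard_univ {K κ : ℕ} (s : Finset (Fin K)) (hs : s.card ≤ κ) :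
    ((Finset.powersetCard κ (Finset.univ : Finset (Fin K))).filter (s ⊆ ·)).card
      = (K - s.card).choose (κ - s.card) := by
  rw [Finset.card_filter_powersetCard_subset _ _ _ (Finset.subset_univ s) hs, Finset.card_fin]

/-- Expand the square and count: an index lies in a fraction κ/K of the κ-subsets, a pair of
distinct indices in a fraction κ(κ-1)/(K(K-1)). -/
lemma sum_powersetCard_sum_sq {K κ : ℕ} (hK : 2 ≤ K) (hκ : 1 ≤ κ) (hκK : κ < K) (a : Fin K → ℝ) :
    ∑ l ∈ Finset.powersetCard κ (Finset.univ : Finset (Fin K)), (∑ j ∈ l, a j) ^ 2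
      = (K.choose κ : ℝ) * ((κ : ℝ) / K * ∑ i, a i ^ 2
          + (κ : ℝ) * (κ - 1) / (K * (K - 1)) * ((∑ i, a i) ^ 2 - ∑ i, a i ^ 2)) := by
  classical
  set P := Finset.powersetCard κ (Finset.univ : Finset (Fin K))
  have hK0 : (K : ℝ) ≠ 0 := by positivity
  have hK1 : (K : ℝ) - 1 ≠ 0 := by
    have : (2 : ℝ) ≤ K := by exact_mod_cast hK
    linarith
  have hone (i : Fin K) : ((P.filter ({i} ⊆ ·)).card : ℝ) = (K.choose κ : ℝ) * (κ / K) := by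
    rw [card_filter_powersetCard_univ _ (by simpa using hκ), Finset.card_singleton]
    obtain ⟨k, rfl⟩ := Nat.exists_eq_add_of_le' hκ
    obtain ⟨n, rfl⟩ := Nat.exists_eq_add_of_le' (show 1 ≤ K by omega)
    have := Nat.add_one_mul_choose_eq n k
    have h : ((n + 1 : ℕ) : ℝ) * n.choose k = (n + 1).choose (k + 1) * ((k + 1 : ℕ) : ℝ) := by
      exact_mod_cast this
    simp only [Nat.add_sub_cancel]
    field_simp
    linarith
  have htwo (i j : Fin K) (hij : i ≠ j) : ((P.filter ({i, j} ⊆ ·)).card : ℝ)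
      = (K.choose κ : ℝ) * (κ * (κ - 1) / (K * (K - 1))) := by
    -- For κ = 1 no subset contains a pair, in agreement with the factor κ - 1; the binomial count
    -- needs κ ≥ 2.
    rcases hκ.eq_or_lt with rfl | h2
    · rw [Finset.filter_false_of_mem]
      · simp
      · intro l hl hs
        have := Finset.card_le_card hs
        rw [Finset.card_pair hij, (Finset.mem_powersetCard.1 hl).2] at this
        omega
    · have hc : ({i, j} : Finset (Fin K)).card = 2 := Finset.card_pair hij
      rw [card_filter_powersetCard_univ _ (by rw [hc]; omega), hc]
      obtain ⟨k, rfl⟩ := Nat.exists_eq_add_of_le' (show 2 ≤ κ by omega)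
      obtain ⟨n, rfl⟩ := Nat.exists_eq_add_of_le' hK
      have h1 : ((n + 1 : ℕ) : ℝ) * n.choose k = (n + 1).choose (k + 1) * ((k + 1 : ℕ) : ℝ) := by
        exact_mod_cast Nat.add_one_mul_choose_eq n k
      have h2 : ((n + 2 : ℕ) : ℝ) * (n + 1).choose (k + 1)
          = (n + 2).choose (k + 2) * ((k + 2 : ℕ) : ℝ) := by
        exact_mod_cast Nat.add_one_mul_choose_eq (n + 1) (k + 1)
      simp only [Nat.add_sub_cancel]
      rw [mul_div_assoc', eq_div_iff (mul_ne_zero hK0 hK1)]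
      push_cast at h1 h2 ⊢
      linear_combination ((n : ℝ) + 2) * h1 + ((k : ℝ) + 1) * h2
  have hexp : ∑ l ∈ P, (∑ j ∈ l, a j) ^ 2
      = ∑ i, ∑ j, a i * a j * ((P.filter ({i, j} ⊆ ·)).card : ℝ) := by
    have : ∀ l ∈ P, (∑ j ∈ l, a j) ^ 2
        = ∑ i, ∑ j, if {i, j} ⊆ l then a i * a j else 0 := by
      intro l _
      rw [sq, Finset.sum_mul_sum, ← Finset.sum_subset (Finset.subset_univ l)]
      · refine Finset.sum_congr rfl fun i hi => ?_
        rw [← Finset.sum_subset (Finset.subset_univ l)]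
        · refine Finset.sum_congr rfl fun j hj => ?_
          rw [if_pos]
          simp [Finset.insert_subset_iff, hi, hj]
        · intro j _ hj
          rw [if_neg]
          simp [Finset.insert_subset_iff, hj]
      · intro i _ hi
        refine Finset.sum_eq_zero fun j _ => ?_
        rw [if_neg]
        simp [Finset.insert_subset_iff, hi]
    rw [Finset.sum_congr rfl this, Finset.sum_comm]
    refine Finset.sum_congr rfl fun i _ => ?_
    rw [Finset.sum_comm]
    refine Finset.sum_congr rfl fun j _ => ?_
    rw [← Finset.sum_filter, Finset.sum_const, nsmul_eq_mul, mul_comm]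
  rw [hexp]
  set p : ℝ := (K.choose κ : ℝ) * (κ / K)
  set q : ℝ := (K.choose κ : ℝ) * (κ * (κ - 1) / (K * (K - 1)))
  have hterm (i j : Fin K) : a i * a j * ((P.filter ({i, j} ⊆ ·)).card : ℝ)
      = q * (a i * a j) + if i = j then (p - q) * a i ^ 2 else 0 := by
    by_cases h : i = j
    · subst h
      rw [Finset.pair_eq_singleton, hone, if_pos rfl]; ring
    · rw [htwo i j h, if_neg h]; ring
  simp_rw [hterm, Finset.sum_add_distrib, Finset.sum_ite_eq, Finset.mem_univ, if_true,
    ← Finset.mul_sum]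
  rw [← Finset.sum_mul]
  simp only [p, q]
  ring

lemma sum_sum_Ioi_sub_sq {K : ℕ} (a : Fin K → ℝ) :
    ∑ i, ∑ j ∈ Finset.Ioi i, (a i - a j) ^ 2 = K * ∑ i, a i ^ 2 - (∑ i, a i) ^ 2 := by
  have h := Finset.sum_sum_Ioi_add_eq_sum_sum_off_diag (fun i j => (a i - a j) ^ 2)
  have h2 : ∑ i, ∑ j ∈ {i}ᶜ, (a j - a i) ^ 2 = ∑ i, ∑ j, (a i - a j) ^ 2 := by
    refine Finset.sum_congr rfl fun i _ => ?_
    rw [← Finset.sum_add_sum_compl {i}]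
    simp [sub_sq_comm]
  have h3 : ∑ i, ∑ j, (a i - a j) ^ 2 = 2 * (K * ∑ i, a i ^ 2 - (∑ i, a i) ^ 2) := by
    have (i j : Fin K) : (a i - a j) ^ 2 = a i ^ 2 - 2 * (a i * a j) + a j ^ 2 := by ring
    simp_rw [this, Finset.sum_add_distrib, Finset.sum_sub_distrib, ← Finset.mul_sum]
    rw [sq (∑ i, a i), Finset.sum_mul_sum]
    simp only [Finset.sum_const, Finset.card_univ, Fintype.card_fin, nsmul_eq_mul,
      ← Finset.mul_sum]
    ring
  have h4 : ∑ i, ∑ j ∈ Finset.Ioi i, ((a j - a i) ^ 2 + (a i - a j) ^ 2)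
      = 2 * ∑ i, ∑ j ∈ Finset.Ioi i, (a i - a j) ^ 2 := by
    simp_rw [Finset.mul_sum]
    refine Finset.sum_congr rfl fun i _ => Finset.sum_congr rfl fun j _ => ?_
    ring
  linarith

/-- Passing to the differences `y - t j` turns every term into a combination of the sum of squares
and the square of the sum. -/
lemma sum_powersetCard_sub_mean_sq {K κ : ℕ} (hK : 2 ≤ K) (hκ : 1 ≤ κ) (hκK : κ < K) (y : ℝ)
    (t : Fin K → ℝ) :
    ∑ l ∈ Finset.powersetCard κ (Finset.univ : Finset (Fin K)), (y - 1 / κ * ∑ j ∈ l, t j) ^ 2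
      = (K.choose κ : ℝ) * ((y - 1 / K * ∑ i, t i) ^ 2
          + ((K : ℝ) - κ) / ((K : ℝ) ^ 2 * κ * ((K : ℝ) - 1))
            * ∑ i, ∑ j ∈ Finset.Ioi i, (t i - t j) ^ 2) := by
  have hK0 : (K : ℝ) ≠ 0 := by positivity
  have hκ0 : (κ : ℝ) ≠ 0 := by positivity
  have hK1 : (K : ℝ) - 1 ≠ 0 := by
    have : (2 : ℝ) ≤ K := by exact_mod_cast hK
    linarith
  have hl : ∀ l ∈ Finset.powersetCard κ (Finset.univ : Finset (Fin K)),
      (y - 1 / κ * ∑ j ∈ l, t j) ^ 2 = (1 / (κ : ℝ)) ^ 2 * (∑ j ∈ l, (y - t j)) ^ 2 := by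
    intro l hl
    rw [Finset.sum_sub_distrib, Finset.sum_const, (Finset.mem_powersetCard.1 hl).2, nsmul_eq_mul]
    field_simp
  have ht : (y - 1 / K * ∑ i, t i) ^ 2 = (1 / (K : ℝ)) ^ 2 * (∑ j, (y - t j)) ^ 2 := by
    rw [Finset.sum_sub_distrib, Finset.sum_const, Finset.card_fin, nsmul_eq_mul]
    field_simp
  have hd : ∑ i, ∑ j ∈ Finset.Ioi i, (t i - t j) ^ 2
      = ∑ i, ∑ j ∈ Finset.Ioi i, ((y - t i) - (y - t j)) ^ 2 :=
    Finset.sum_congr rfl fun i _ => Finset.sum_congr rfl fun j _ => by ring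
  rw [Finset.sum_congr rfl hl, ← Finset.mul_sum, sum_powersetCard_sum_sq hK hκ hκK, ht, hd,
    sum_sum_Ioi_sub_sq]
  field_simp
  ring

/-- The distortion over the subsets of `κ` descriptions splits into a centroid part and a part that
depends on the pairwise distances only. -/
lemma receptionSum_eq {L K κ : ℕ} (hK : 2 ≤ K) (hκ : 1 ≤ κ) (hκK : κ < K) (V : Finset (E L))
    (α : E L → Fin K → E L) :
    receptionSum κ V α = (K.choose κ : ℝ) * (centroidSum V α
      + ((K : ℝ) - κ) / ((K : ℝ) ^ 2 * κ * ((K : ℝ) - 1)) * spsdSum V α) := by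
  have hx (x : E L) : ∑ l ∈ Finset.powersetCard κ (Finset.univ : Finset (Fin K)),
      sqNorm (x - (1 / (κ : ℝ)) • ∑ j ∈ l, α x j) = (K.choose κ : ℝ) * (centroidSq x (α x)
      + ((K : ℝ) - κ) / ((K : ℝ) ^ 2 * κ * ((K : ℝ) - 1)) * spsd (α x)) := by
    simp only [sqNorm, centroidSq, spsd, ← Finset.sum_div]
    rw [Finset.sum_comm, mul_div_assoc', ← add_div, mul_div_assoc']
    congr 1
    have h (m : Fin L) := sum_powersetCard_sub_mean_sq hK hκ hκK (x m) (fun i => α x i m)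
    simp only [PiLp.sub_apply, PiLp.smul_apply, WithLp.ofLp_sum, Finset.sum_apply, smul_eq_mul]
    rw [Finset.sum_congr rfl fun m _ => h m, ← Finset.mul_sum, Finset.sum_add_distrib,
      ← Finset.mul_sum]
    congr 3
    rw [Finset.sum_comm]
    exact Finset.sum_congr rfl fun i _ => Finset.sum_comm
  rw [receptionSum, Finset.sum_comm, Finset.sum_congr rfl fun x _ => hx x, ← Finset.mul_sum,
    Finset.sum_add_distrib, ← Finset.mul_sum]
  rfl

/-- Strict positivity of `A` allows it to be cancelled when costs are compared; `B` only has to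
preserve inequalities between SPSD sums. -/
lemma exists_cost_eq {K N : ℕ} {p : ℝ} (hK : 2 ≤ K) (hN : 0 < N) (h0 : 0 < p) (h1 : p < 1)
    (L : ℕ) : ∃ A B : ℝ, 0 < A ∧ 0 ≤ B ∧ ∀ (V : Finset (E L)) (α : E L → Fin K → E L),
      cost p N V α = A * centroidSum V α + B * spsdSum V α := by
  have hw (κ : ℕ) : 0 < (1 - p) ^ κ * p ^ (K - κ) / (N : ℝ) ^ 2 := by
    have := sub_pos.2 h1
    positivity
  refine ⟨∑ κ ∈ Finset.Icc 1 (K - 1), (1 - p) ^ κ * p ^ (K - κ) / (N : ℝ) ^ 2 * K.choose κ,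
    ∑ κ ∈ Finset.Icc 1 (K - 1), (1 - p) ^ κ * p ^ (K - κ) / (N : ℝ) ^ 2 * (K.choose κ *
      (((K : ℝ) - κ) / ((K : ℝ) ^ 2 * κ * ((K : ℝ) - 1)))), ?_, ?_, fun V α => ?_⟩
  · refine Finset.sum_pos (fun κ hκ => ?_) ⟨1, Finset.mem_Icc.2 (by omega)⟩
    have hκ := Finset.mem_Icc.1 hκ
    have : 0 < K.choose κ := Nat.choose_pos (by omega)
    have := hw κ
    positivity
  · refine Finset.sum_nonneg fun κ hκ => mul_nonneg (hw κ).le (mul_nonneg (by positivity) ?_)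
    have hκ := Finset.mem_Icc.1 hκ
    have h : (κ : ℝ) ≤ K := by exact_mod_cast (show κ ≤ K by omega)
    have h2 : (1 : ℝ) ≤ K := by exact_mod_cast (show 1 ≤ K by omega)
    exact div_nonneg (by linarith) (mul_nonneg (by positivity) (by linarith))
  · rw [cost, Finset.sum_mul, Finset.sum_mul, ← Finset.sum_add_distrib]
    refine Finset.sum_congr rfl fun κ hκ => ?_
    have hκ := Finset.mem_Icc.1 hκ
    rw [receptionSum_eq hK hκ.1 (by omega)]
    ring

/-! ### Lattice geometry: covering radius, points in a ball, similarity -/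

lemma exists_covering_radius {L : ℕ} (Λ : Submodule ℤ (E L)) [DiscreteTopology Λ]
    [IsZLattice ℝ Λ] : ∃ r : ℝ, 0 < r ∧ ∀ x, ∃ v ∈ Λ, ‖x - v‖ ≤ r := by
  have : Module.Finite ℤ Λ := ZLattice.module_finite ℝ Λ
  have : Module.Free ℤ Λ := ZLattice.module_free ℝ Λ
  let b₀ := Module.Free.chooseBasis ℤ Λ
  let b := b₀.ofZLatticeBasis ℝ Λ
  -- Rounding down in a lattice basis leaves a remainder in the fundamental parallelepiped; the
  -- extra 1 keeps the radius positive even for an empty basis.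
  refine ⟨∑ i, ‖b i‖ + 1, by positivity, fun x => ⟨ZSpan.floor b x, ?_, ?_⟩⟩
  · exact (b₀.ofZLatticeBasis_span ℝ).le (ZSpan.floor b x).2
  · have := ZSpan.norm_fract_le b x
    rw [ZSpan.fract_apply] at this
    linarith

/-- In a lattice basis, points of norm at most ρ have integer coordinates of size at most Mρ, where
M exceeds the operator norm of the coordinate map. -/
lemma exists_card_ball_le {L : ℕ} (Λ : Submodule ℤ (E L)) [DiscreteTopology Λ]
    [IsZLattice ℝ Λ] : ∃ M : ℝ, 0 < M ∧ ∀ ρ : ℝ, 0 ≤ ρ → ∃ B : Finset (E L),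
      (∀ v ∈ Λ, ‖v‖ ≤ ρ → v ∈ B) ∧ (B.card : ℝ) ≤ (2 * M * ρ + 1) ^ L := by
  classical
  have hfr : Module.finrank ℤ Λ = L := by
    rw [ZLattice.rank ℝ Λ, finrank_euclideanSpace, Fintype.card_fin]
  have : Module.Finite ℤ Λ := ZLattice.module_finite ℝ Λ
  have : Module.Free ℤ Λ := ZLattice.module_free ℝ Λ
  let b₀ : Module.Basis (Fin L) ℤ Λ := Module.finBasisOfFinrankEq ℤ Λ hfr
  let b := b₀.ofZLatticeBasis ℝ Λ
  let T : E L →L[ℝ] (Fin L → ℝ) := LinearMap.toContinuousLinearMap b.equivFun.toLinearMap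
  refine ⟨‖T‖ + 1, by positivity, fun ρ hρ => ?_⟩
  set m : ℤ := ⌊(‖T‖ + 1) * ρ⌋
  have hm0 : 0 ≤ m := Int.floor_nonneg.2 (by positivity)
  have hm : (m : ℝ) ≤ (‖T‖ + 1) * ρ := Int.floor_le _
  refine ⟨(Fintype.piFinset fun _ : Fin L => Finset.Icc (-m) m).image
    (fun n => ∑ i, (n i : ℝ) • b i), fun v hv hvρ => ?_, ?_⟩
  · rw [Finset.mem_image]
    have hr (i : Fin L) : ((b₀.repr ⟨v, hv⟩ i : ℤ) : ℝ) = b.repr v i :=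
      (b₀.ofZLatticeBasis_repr_apply ℝ Λ ⟨v, hv⟩ i).symm
    refine ⟨fun i => b₀.repr ⟨v, hv⟩ i, ?_, ?_⟩
    · rw [Fintype.mem_piFinset]
      intro i
      have h1 : |b.repr v i| ≤ (‖T‖ + 1) * ρ := by
        calc |b.repr v i| = ‖T v i‖ := rfl
          _ ≤ ‖T v‖ := norm_le_pi_norm _ i
          _ ≤ ‖T‖ * ‖v‖ := T.le_opNorm v
          _ ≤ (‖T‖ + 1) * ρ := by gcongr; linarith
      rw [← hr] at h1
      rw [Finset.mem_Icc, ← abs_le]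
      exact Int.le_floor.2 (by exact_mod_cast h1)
    · simp_rw [hr]
      exact b.sum_repr v
  · calc _ ≤ ((Fintype.piFinset fun _ : Fin L => Finset.Icc (-m) m).card : ℝ) := by
          exact_mod_cast Finset.card_image_le
      _ = (2 * (m : ℝ) + 1) ^ L := by
          rw [Fintype.card_piFinset_const, Int.card_Icc]
          have : ((m + 1 - -m).toNat : ℝ) = 2 * (m : ℝ) + 1 := by
            have : ((m + 1 - -m).toNat : ℤ) = 2 * m + 1 := by omega
            exact_mod_cast this
          push_cast
          rw [this]
      _ ≤ _ := by
          have : (0 : ℝ) ≤ m := by exact_mod_cast hm0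
          exact pow_le_pow_left₀ (by positivity) (by linarith) _

open scoped Pointwise in
-- The similar lattice is the preimage of Λ under the inverse similarity, so bases and fundamental
-- domains are carried over. The isometry preserves volume and the scaling contributes `c ^ L`.
lemma isZLattice_and_covolume_of_similar {L : ℕ} {Λ Λ' : Submodule ℤ (E L)}
    [DiscreteTopology Λ] [IsZLattice ℝ Λ] {c : ℝ} (hc : 0 < c) {U : E L ≃ₗᵢ[ℝ] E L}
    (h : (Λ' : Set (E L)) = (fun x => c • U x) '' (Λ : Set (E L))) :
    ∃ _ : DiscreteTopology Λ', IsZLattice ℝ Λ' ∧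
      ZLattice.covolume Λ' volume = c ^ L * ZLattice.covolume Λ volume := by
  let e : E L ≃L[ℝ] E L :=
    ((U.toLinearEquiv.trans (LinearEquiv.smulOfNeZero ℝ (E L) c hc.ne')).symm).toContinuousLinearEquiv
  have he (x : E L) : e.symm x = c • U x := rfl
  have hΛ : Λ' = ZLattice.comap ℝ Λ e.toLinearMap := by
    apply SetLike.coe_injective
    rw [h, ZLattice.coe_comap]
    exact e.symm.image_eq_preimage_symm (Λ : Set (E L))
  subst hΛ
  refine ⟨inferInstance, inferInstance, ?_⟩
  have : Module.Finite ℤ Λ := ZLattice.module_finite ℝ Λ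
  have : Module.Free ℤ Λ := ZLattice.module_free ℝ Λ
  let b := Module.Free.chooseBasis ℤ Λ
  rw [ZLattice.covolume_eq_measure_fundamentalDomain _ _ (ZLattice.isAddFundamentalDomain
      (b.ofZLatticeComap ℝ Λ e.toLinearEquiv) volume),
    ZLattice.covolume_eq_measure_fundamentalDomain _ _ (ZLattice.isAddFundamentalDomain b volume),
    Module.Basis.ofZLatticeBasis_comap, ← ZSpan.map_fundamentalDomain]
  set F := ZSpan.fundamentalDomain (b.ofZLatticeBasis ℝ Λ)
  have hF : (e.symm.toLinearEquiv '' F) = c • (U.symm ⁻¹' F) := by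
    rw [← LinearIsometryEquiv.image_eq_preimage_symm, ← Set.image_smul, Set.image_image]
    rfl
  rw [hF, Measure.real, Measure.addHaar_smul, finrank_euclideanSpace, Fintype.card_fin,
    U.symm.measurePreserving.measure_preimage
      (ZSpan.fundamentalDomain_measurableSet _).nullMeasurableSet,
    ENNReal.toReal_mul, abs_of_pos (pow_pos hc L), ENNReal.toReal_ofReal (pow_pos hc L).le]
  rfl

/-! ### Shapes of tuples and their multiplicities -/

/-- The tuple of differences with the component `i₀`. -/
def shape {L K : ℕ} (i₀ : Fin K) (t : Fin K → E L) : Fin K → E L := fun i => t i - t i₀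

lemma spsd_shape {L K : ℕ} (i₀ : Fin K) (t : Fin K → E L) : spsd (shape i₀ t) = spsd t := by
  simp [spsd, shape]

lemma card_le_latticeIndex {L : ℕ} {ι : Type*} {Λ Λ' : Submodule ℤ (E L)} {W : Finset ι}
    (h0 : latticeIndex Λ Λ' ≠ 0) (h : ι → E L) (hmem : ∀ x ∈ W, h x ∈ Λ)
    (hinj : ∀ x ∈ W, ∀ y ∈ W, h x - h y ∈ Λ' → x = y) : W.card ≤ latticeIndex Λ Λ' := by
  let H := Λ'.toAddSubgroup.addSubgroupOf Λ.toAddSubgroup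
  have hH : Nat.card (Λ.toAddSubgroup ⧸ H) = latticeIndex Λ Λ' := rfl
  -- A nonzero index excludes an infinite quotient, whose index is 0 by convention.
  have : Finite (Λ.toAddSubgroup ⧸ H) := Nat.finite_of_card_ne_zero (hH ▸ h0)
  let g : W → Λ.toAddSubgroup ⧸ H := fun x => QuotientAddGroup.mk ⟨h x, hmem x x.2⟩
  have hg : Function.Injective g := by
    intro x y hxy
    have := QuotientAddGroup.eq.1 hxy.symm
    refine Subtype.ext (hinj x x.2 y y.2 ?_)
    rw [sub_eq_neg_add]
    exact this
  rw [← hH, ← Nat.card_eq_finsetCard]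
  exact Nat.card_le_card_of_injective g hg

lemma IsVoronoiLabelSet.card_eq {L : ℕ} {Λc Λp : Submodule ℤ (E L)} {V : Finset (E L)}
    (hV : IsVoronoiLabelSet Λc Λp V) : V.card = latticeIndex Λc Λp := by
  let H := Λp.toAddSubgroup.addSubgroupOf Λc.toAddSubgroup
  have hH : Nat.card (Λc.toAddSubgroup ⧸ H) = latticeIndex Λc Λp := rfl
  let g : V → Λc.toAddSubgroup ⧸ H := fun x => QuotientAddGroup.mk ⟨x, hV.mem_lattice x x.2⟩
  have hg : Function.Bijective g := by
    constructor
    · intro x y hxy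
      have h : (x : E L) - y ∈ Λp := by
        rw [sub_eq_neg_add]
        exact QuotientAddGroup.eq.1 hxy.symm
      refine Subtype.ext ((hV.existsUnique_rep x (hV.mem_lattice x x.2)).unique ⟨x.2, by simp⟩
        ⟨y.2, h⟩)
    · intro q
      obtain ⟨x, rfl⟩ := QuotientAddGroup.mk_surjective q
      obtain ⟨v, ⟨hv, hxv⟩, -⟩ := hV.existsUnique_rep x x.2
      refine ⟨⟨v, hv⟩, QuotientAddGroup.eq.2 ?_⟩
      have : -v + (x : E L) ∈ Λp := by rwa [← sub_eq_neg_add]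
      exact this
  rw [← hH, ← Nat.card_eq_of_bijective g hg, Nat.card_eq_finsetCard]

lemma IsVoronoiLabelSet.card_eq_mul {L N M : ℕ} {Λc Λs Λp : Submodule ℤ (E L)} {V : Finset (E L)}
    (hV : IsVoronoiLabelSet Λc Λp V) (hps : Λp ≤ Λs) (hsc : Λs ≤ Λc)
    (hcs : latticeIndex Λc Λs = N) (hsp : latticeIndex Λs Λp = M) : V.card = M * N := by
  rw [hV.card_eq, latticeIndex, ← AddSubgroup.relIndex_mul_relIndex Λp.toAddSubgroup
    Λs.toAddSubgroup Λc.toAddSubgroup hps hsc]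
  exact congrArg₂ (· * ·) hsp hcs

/-- If two points of V have equal shapes and their `i₀`-labels agree modulo Λp, then shift
invariance and injectivity make the points themselves congruent modulo Λp, hence equal. So a shape
occurs at most once per class of Λs modulo Λp. -/
lemma card_filter_shape_le {L K : ℕ} {Λc Λs Λp : Submodule ℤ (E L)} {V : Finset (E L)}
    {α : E L → Fin K → E L} [DecidableEq (Fin K → E L)] (hps : Λp ≤ Λs) (hsc : Λs ≤ Λc)
    (h0 : latticeIndex Λs Λp ≠ 0) (hV : IsVoronoiLabelSet Λc Λp V) (hα : IsLabeling Λc Λs Λp α)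
    (i₀ : Fin K) (S : Fin K → E L) :
    (V.filter (fun x => shape i₀ (α x) = S)).card ≤ latticeIndex Λs Λp := by
  refine card_le_latticeIndex h0 (fun x => α x i₀) (fun x hx => ?_) (fun x hx y hy hxy => ?_)
  · exact hα.mem x (hV.mem_lattice x (Finset.mem_filter.1 hx).1) i₀
  · rw [Finset.mem_filter] at hx hy
    have hxc := hV.mem_lattice x hx.1
    have hyc := hV.mem_lattice y hy.1
    have hxy' : x = y + (α x i₀ - α y i₀) := by
      refine hα.injOn hxc (Λc.add_mem hyc (hsc (hps hxy))) (funext fun i => ?_)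
      rw [hα.shift y hyc _ hxy]
      have := congrFun (hx.2.trans hy.2.symm) i
      simp only [shape] at this
      rw [sub_eq_iff_eq_add] at this
      rw [this]; abel
    refine (hV.existsUnique_rep x hxc).unique ⟨hx.1, by simp⟩ ⟨hy.1, ?_⟩
    have : x - y = α x i₀ - α y i₀ := by nth_rewrite 1 [hxy']; abel
    rwa [this]

/-- Filling the `N` cheapest cells of capacity `N` is the cheapest way to place `N * N` items. -/
lemma exists_cheap_subset {ι : Type*} (I : Finset ι) (f : ι → ℝ) (m : ι → ℕ) {N : ℕ} (hN : 0 < N)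
    (hm : ∀ s ∈ I, m s ≤ N) (hsum : ∑ s ∈ I, m s = N * N) :
    ∃ T ⊆ I, T.card = N ∧ (N : ℝ) * ∑ s ∈ T, f s ≤ ∑ s ∈ I, m s * f s := by
  classical
  have hI : N ≤ I.card := by
    have := Finset.sum_le_card_nsmul I m N hm
    rw [hsum, smul_eq_mul] at this
    exact Nat.le_of_mul_le_mul_right this hN
  obtain ⟨T, hT, hmin⟩ := Finset.exists_min_image (Finset.powersetCard N I)
    (fun T => ∑ s ∈ T, f s) (Finset.powersetCard_nonempty.2 hI)
  rw [Finset.mem_powersetCard] at hT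
  refine ⟨T, hT.1, hT.2, ?_⟩
  -- Exchange argument: swapping `t` for a cheaper `s` would contradict minimality of `T`.
  have hle : ∀ t ∈ T, ∀ s ∈ I \ T, f t ≤ f s := by
    intro t ht s hs
    rw [Finset.mem_sdiff] at hs
    have hs' : s ∉ T.erase t := fun h => hs.2 (Finset.mem_of_mem_erase h)
    have := hmin (insert s (T.erase t)) (by
      rw [Finset.mem_powersetCard]
      refine ⟨Finset.insert_subset hs.1 ((Finset.erase_subset _ _).trans hT.1), ?_⟩
      rw [Finset.card_insert_of_notMem hs', Finset.card_erase_add_one ht, hT.2])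
    rw [Finset.sum_insert hs', ← Finset.add_sum_erase T f ht] at this
    linarith
  -- The price `f t₀` separates `T` from the rest, and the free capacity in `T` equals the number of
  -- items outside, so moving them in cannot raise the cost.
  obtain ⟨t₀, ht₀, hmax⟩ := Finset.exists_max_image T f (Finset.card_pos.1 (hT.2 ▸ hN))
  have h1 : ∑ s ∈ I, (m s : ℝ) * f s = ∑ s ∈ I \ T, (m s : ℝ) * f s + ∑ s ∈ T, (m s : ℝ) * f s :=
    (Finset.sum_sdiff hT.1).symm
  have h2 : (∑ s ∈ I \ T, (m s : ℝ)) + ∑ s ∈ T, (m s : ℝ) = N * N := by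
    rw [Finset.sum_sdiff hT.1]; exact_mod_cast hsum
  have h3 : (∑ s ∈ I \ T, (m s : ℝ)) * f t₀ ≤ ∑ s ∈ I \ T, (m s : ℝ) * f s := by
    rw [Finset.sum_mul]
    exact Finset.sum_le_sum fun s hs => mul_le_mul_of_nonneg_left (hle t₀ ht₀ s hs) (by positivity)
  have h4 : ∑ s ∈ T, ((N : ℝ) - m s) * f s ≤ (∑ s ∈ T, ((N : ℝ) - m s)) * f t₀ := by
    rw [Finset.sum_mul]
    refine Finset.sum_le_sum fun s hs => mul_le_mul_of_nonneg_left (hmax s hs) ?_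
    have : (m s : ℝ) ≤ N := by exact_mod_cast hm s (hT.1 hs)
    linarith
  simp only [sub_mul, Finset.sum_sub_distrib, Finset.sum_const, hT.2, nsmul_eq_mul,
    ← Finset.mul_sum] at h4
  have h5 := congrArg (· * f t₀) h2
  simp only [add_mul] at h5
  linarith

/-- If the cells of capacity `N` in `T`, `N` in number, hold `N * N` items, they are all full. -/
lemma sum_eq_of_fibers_le {ι σ : Type*} [DecidableEq σ] (V : Finset ι) (T : Finset σ) (g : ι → σ)
    (f : σ → ℝ) {N : ℕ} (hg : ∀ x ∈ V, g x ∈ T) (hV : V.card = N * N) (hT : T.card = N)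
    (hfib : ∀ s ∈ T, (V.filter (fun x => g x = s)).card ≤ N) :
    ∑ x ∈ V, f (g x) = N * ∑ s ∈ T, f s := by
  have hfull : ∀ s ∈ T, (V.filter (fun x => g x = s)).card = N := by
    refine (Finset.sum_eq_sum_iff_of_le hfib).1 ?_
    rw [← Finset.card_eq_sum_card_fiberwise hg, hV, Finset.sum_const, hT, smul_eq_mul]
  rw [← Finset.sum_fiberwise_of_maps_to hg, Finset.mul_sum]
  refine Finset.sum_congr rfl fun s hs => ?_
  rw [Finset.sum_congr rfl (g := fun _ => f s) fun x hx => by rw [(Finset.mem_filter.1 hx).2],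
    Finset.sum_const, hfull s hs, nsmul_eq_mul]

/-! ### Construction of a competing labeling -/

/-- Given `N` tuples of pairwise different shapes, there is a labeling that uses only translates
of them and whose centroids are within twice the covering radius of `Λs`. -/
lemma exists_labeling_of_shapes {L K : ℕ} {Λc Λs Λp : Submodule ℤ (E L)} (hps : Λp ≤ Λs)
    (hsc : Λs ≤ Λc) (hN : 0 < latticeIndex Λc Λs) (hK : 0 < K) {r : ℝ}
    (hr : ∀ x, ∃ v ∈ Λs, ‖x - v‖ ≤ r) (i₀ : Fin K) (T : Finset (Fin K → E L))
    (hT : T.card = latticeIndex Λc Λs) (hTs : ∀ S ∈ T, ∀ i, S i ∈ Λs) (hT0 : ∀ S ∈ T, S i₀ = 0) :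
    ∃ β : E L → Fin K → E L, IsLabeling Λc Λs Λp β ∧ (∀ x ∈ Λc, shape i₀ (β x) ∈ T) ∧
      ∀ x ∈ Λc, ‖x - (1 / (K : ℝ)) • ∑ i, β x i‖ ≤ 2 * r := by
  classical
  choose nr hnr hnr_le using hr
  let H := Λs.toAddSubgroup.addSubgroupOf Λc.toAddSubgroup
  have hH : Nat.card (Λc.toAddSubgroup ⧸ H) = latticeIndex Λc Λs := rfl
  have : Finite (Λc.toAddSubgroup ⧸ H) := Nat.finite_of_card_ne_zero (hH ▸ hN.ne')
  obtain ⟨e⟩ : Nonempty ((Λc.toAddSubgroup ⧸ H) ≃ T) :=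
    Finite.card_eq.1 (by rw [hH, Nat.card_eq_finsetCard, hT])
  let π : Λc → Λc.toAddSubgroup ⧸ H := fun x => QuotientAddGroup.mk (s := H) x
  have hπ (x y : Λc) : π x = π y ↔ (y : E L) - x ∈ Λs := by
    rw [sub_eq_neg_add]
    exact QuotientAddGroup.eq
  -- A short representative of each coset, of norm at most `r`.
  let ρ : Λc.toAddSubgroup ⧸ H → E L := fun q => (q.out : E L) - nr (q.out : E L)
  have hρ_le (q) : ‖ρ q‖ ≤ r := hnr_le _
  have hρ (x : Λc) : (x : E L) - ρ (π x) ∈ Λs := by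
    have h1 : π (Quotient.out (π x)) = π x := QuotientAddGroup.out_eq' _
    have h2 := (hπ _ _).1 h1
    have h3 : (x : E L) - ρ (π x) = (x - (Quotient.out (π x) : Λc.toAddSubgroup))
      + nr (Quotient.out (π x) : Λc.toAddSubgroup) := by simp only [ρ]; abel
    rw [h3]
    exact Λs.add_mem h2 (hnr _)
  let w : (Fin K → E L) → E L := fun S => nr ((1 / (K : ℝ)) • ∑ i, S i)
  -- The shape of the coset of `x` is translated within Λs. Its centroid misses `x` only by `ρ` and
  -- by the error of rounding the centroid of the shape to `w`, which gives the bound `2 * r`.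
  let β' : Λc → Fin K → E L := fun x i => (e (π x) : Fin K → E L) i + (x - ρ (π x) - w (e (π x)))
  have hβ'_shape (x : Λc) : shape i₀ (β' x) = e (π x) := by
    funext i
    simp [shape, β', hT0 _ (e (π x)).2]
  let β : E L → Fin K → E L := fun x => if h : x ∈ Λc then β' ⟨x, h⟩ else 0
  have hβ (x : E L) (h : x ∈ Λc) : β x = β' ⟨x, h⟩ := dif_pos h
  refine ⟨β, ⟨fun x hx i => ?_, fun x hx y hy hxy => ?_, fun x hx y hy i => ?_⟩,
    fun x hx => ?_, fun x hx => ?_⟩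
  · rw [hβ x hx]
    exact Λs.add_mem (hTs _ (e _).2 i) (Λs.sub_mem (hρ ⟨x, hx⟩) (hnr _))
  · change x ∈ Λc at hx
    change y ∈ Λc at hy
    rw [hβ x hx, hβ y hy] at hxy
    -- The shape determines the coset; within a coset the component `i₀` determines the point.
    have h1 : π ⟨x, hx⟩ = π ⟨y, hy⟩ := by
      apply e.injective
      apply Subtype.ext
      rw [← hβ'_shape, ← hβ'_shape, hxy]
    have h2 := congrFun hxy i₀
    simp only [β', h1] at h2
    simpa using h2
  · have hyc := hsc (hps hy)
    have h1 : π ⟨x + y, Λc.add_mem hx hyc⟩ = π ⟨x, hx⟩ := by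
      rw [hπ]
      simpa using hps hy
    rw [hβ x hx, hβ _ (Λc.add_mem hx hyc)]
    simp only [β', h1]
    abel
  · rw [hβ x hx, hβ'_shape]
    exact (e _).2
  · rw [hβ x hx]
    set q := π ⟨x, hx⟩
    have hK' : (K : ℝ) ≠ 0 := by positivity
    have h1 : x - (1 / (K : ℝ)) • ∑ i, β' ⟨x, hx⟩ i
        = ρ q - ((1 / (K : ℝ)) • ∑ i, (e q : Fin K → E L) i - w (e q)) := by
      simp only [β', Finset.sum_add_distrib, Finset.sum_const, Finset.card_univ, Fintype.card_fin,
        smul_add, ← Nat.cast_smul_eq_nsmul ℝ, smul_smul, one_div, inv_mul_cancel₀ hK', one_smul]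
      abel
    rw [h1, two_mul]
    exact (norm_sub_le _ _).trans (add_le_add (hρ_le q) (hnr_le _))

/-- Every labeling can be replaced by one of no larger pairwise distances, whose centroids are at
a distance of the order of the covering radius of the sublattice. -/
lemma exists_labeling_spsdSum_le {L K N : ℕ} {Λc Λs Λp : Submodule ℤ (E L)} {V : Finset (E L)}
    {α : E L → Fin K → E L} (hK : 0 < K) (hN : 0 < N) (hps : Λp ≤ Λs)
    (hsc : Λs ≤ Λc) (hcs : latticeIndex Λc Λs = N) (hsp : latticeIndex Λs Λp = N)
    (hV : IsVoronoiLabelSet Λc Λp V) (hα : IsLabeling Λc Λs Λp α) {r : ℝ}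
    (hr : ∀ x, ∃ v ∈ Λs, ‖x - v‖ ≤ r) :
    ∃ β : E L → Fin K → E L, IsLabeling Λc Λs Λp β ∧ spsdSum V β ≤ spsdSum V α ∧
      centroidSum V β ≤ (N : ℝ) ^ 2 * ((2 * r) ^ 2 / L) := by
  classical
  let i₀ : Fin K := ⟨0, hK⟩
  have hcard : V.card = N * N := hV.card_eq_mul hps hsc hcs hsp
  have hfib {γ : E L → Fin K → E L} (hγ : IsLabeling Λc Λs Λp γ) (S : Fin K → E L) :
      (V.filter (fun x => shape i₀ (γ x) = S)).card ≤ N :=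
    hsp ▸ card_filter_shape_le hps hsc (by omega) hV hγ i₀ S
  let I := V.image (fun x => shape i₀ (α x))
  have hI : ∀ x ∈ V, shape i₀ (α x) ∈ I := fun x hx => Finset.mem_image_of_mem _ hx
  obtain ⟨T, hTI, hTN, hT⟩ := exists_cheap_subset I spsd
    (fun S => (V.filter (fun x => shape i₀ (α x) = S)).card) hN (fun S _ => hfib hα S)
    (by rw [← Finset.card_eq_sum_card_fiberwise hI, hcard])
  have hαsum : spsdSum V α
      = ∑ S ∈ I, ((V.filter (fun x => shape i₀ (α x) = S)).card : ℝ) * spsd S := by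
    change ∑ x ∈ V, spsd (α x) = _
    rw [← Finset.sum_fiberwise_of_maps_to hI]
    refine Finset.sum_congr rfl fun S _ => ?_
    rw [Finset.sum_congr rfl (g := fun _ => spsd S) fun x hx => by
      rw [← (Finset.mem_filter.1 hx).2, spsd_shape], Finset.sum_const, nsmul_eq_mul]
  have hTs : ∀ S ∈ T, ∃ x ∈ V, shape i₀ (α x) = S := fun S hS => Finset.mem_image.1 (hTI hS)
  obtain ⟨β, hβ, hβT, hβc⟩ := exists_labeling_of_shapes hps hsc (by omega) hK hr i₀ T
    (hTN.trans hcs.symm) (by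
      intro S hS i
      obtain ⟨x, hx, rfl⟩ := hTs S hS
      have hxc := hV.mem_lattice x hx
      exact Λs.sub_mem (hα.mem x hxc i) (hα.mem x hxc i₀)) (by
      intro S hS
      obtain ⟨x, hx, rfl⟩ := hTs S hS
      exact sub_self _)
  refine ⟨β, hβ, ?_, ?_⟩
  · rw [hαsum]
    -- The N² points share N shapes of capacity N, so β uses each shape of `T` exactly N times.
    refine le_trans (le_of_eq ?_) hT
    rw [← sum_eq_of_fibers_le V T (fun x => shape i₀ (β x)) spsd
      (fun x hx => hβT x (hV.mem_lattice x hx)) hcard hTN (fun S _ => hfib hβ S)]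
    exact Finset.sum_congr rfl fun x _ => (spsd_shape i₀ _).symm
  · refine (Finset.sum_le_card_nsmul V _ ((2 * r) ^ 2 / L) fun x hx => ?_).trans (le_of_eq ?_)
    · rw [sqNorm_eq]
      have := hβc x (hV.mem_lattice x hx)
      gcongr
    · rw [hcard, nsmul_eq_mul]
      push_cast
      ring

/-! ### Transport along similarities and the lower bound for the SPSD -/

lemma exists_mem_near_of_similar {L : ℕ} {Λ Λ' : Submodule ℤ (E L)} {c r : ℝ} (hc : 0 < c)
    {U : E L ≃ₗᵢ[ℝ] E L} (h : (Λ' : Set (E L)) = (fun x => c • U x) '' (Λ : Set (E L)))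
    (hr : ∀ x, ∃ v ∈ Λ, ‖x - v‖ ≤ r) (x : E L) : ∃ v ∈ Λ', ‖x - v‖ ≤ c * r := by
  obtain ⟨v, hv, hxv⟩ := hr (U.symm (c⁻¹ • x))
  have hv' : c • U v ∈ (Λ' : Set (E L)) := h ▸ ⟨v, hv, rfl⟩
  refine ⟨c • U v, hv', ?_⟩
  have : x - c • U v = c • U (U.symm (c⁻¹ • x) - v) := by
    rw [map_sub, U.apply_symm_apply, smul_sub, smul_inv_smul₀ hc.ne']
  rw [this, norm_smul, U.norm_map, Real.norm_of_nonneg hc.le]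
  gcongr

lemma exists_card_ball_le_of_similar {L : ℕ} {Λ Λ' : Submodule ℤ (E L)} {c ρ b : ℝ} (hc : 0 < c)
    {U : E L ≃ₗᵢ[ℝ] E L} (h : (Λ' : Set (E L)) = (fun x => c • U x) '' (Λ : Set (E L)))
    (hB : ∃ B : Finset (E L), (∀ v ∈ Λ, ‖v‖ ≤ ρ → v ∈ B) ∧ (B.card : ℝ) ≤ b) :
    ∃ B : Finset (E L), (∀ v ∈ Λ', ‖v‖ ≤ c * ρ → v ∈ B) ∧ (B.card : ℝ) ≤ b := by
  classical
  obtain ⟨B, hB, hb⟩ := hB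
  refine ⟨B.image (fun x => c • U x), fun w hw hwρ => ?_,
    le_trans (by exact_mod_cast Finset.card_image_le) hb⟩
  have hw' : w ∈ (Λ' : Set (E L)) := hw
  rw [h] at hw'
  obtain ⟨v, hv, rfl⟩ := hw'
  refine Finset.mem_image_of_mem (fun x => c • U x) (hB v hv ?_)
  simp only [norm_smul, U.norm_map, Real.norm_of_nonneg hc.le] at hwρ
  exact le_of_mul_le_mul_left hwρ hc

/-- A lower bound for the sum of pairwise squared distances: there are few tuples with small
distances. -/
lemma le_spsdSum {L K N : ℕ} {Λc Λs Λp : Submodule ℤ (E L)} {V : Finset (E L)}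
    {α : E L → Fin K → E L} (hK : 0 < K) (hN : 0 < N) (hps : Λp ≤ Λs)
    (hsc : Λs ≤ Λc) (hcs : latticeIndex Λc Λs = N) (hsp : latticeIndex Λs Λp = N)
    (hV : IsVoronoiLabelSet Λc Λp V) (hα : IsLabeling Λc Λs Λp α) {R : ℝ} (hR : 0 ≤ R)
    (B : Finset (E L)) (hB : ∀ v ∈ Λs, ‖v‖ ≤ R → v ∈ B)
    (hBN : 2 * (B.card : ℝ) ^ (K - 1) ≤ N) :
    (N : ℝ) ^ 2 / 2 * (R ^ 2 / L) ≤ spsdSum V α := by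
  classical
  let i₀ : Fin K := ⟨0, hK⟩
  rcases L.eq_zero_or_pos with rfl | hL
  · simp only [Nat.cast_zero, div_zero, mul_zero]
    exact Finset.sum_nonneg fun x _ => spsd_nonneg (α x)
  have hL' : (0 : ℝ) < L := by exact_mod_cast hL
  have hcard : V.card = N * N := hV.card_eq_mul hps hsc hcs hsp
  -- All shapes of small SPSD lie here; the component `i₀` is zero, which leaves K - 1 free choices.
  let P : Finset (Fin K → E L) := Fintype.piFinset fun i => if i = i₀ then {0} else B
  have hP : P.card = B.card ^ (K - 1) := by
    rw [Fintype.card_piFinset, ← Finset.mul_prod_erase _ _ (Finset.mem_univ i₀), if_pos rfl,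
      Finset.prod_congr rfl (g := fun _ => B.card) fun i hi => by
        rw [if_neg (Finset.ne_of_mem_erase hi)], Finset.prod_const,
      Finset.card_erase_of_mem (Finset.mem_univ _), Finset.card_singleton, one_mul,
      Finset.card_fin]
  let W := V.filter (fun x => spsd (α x) ≤ R ^ 2 / L)
  have hWP : ∀ x ∈ W, shape i₀ (α x) ∈ P := by
    intro x hx
    obtain ⟨hxV, hxR⟩ := Finset.mem_filter.1 hx
    have hxc := hV.mem_lattice x hxV
    rw [Fintype.mem_piFinset]
    intro i
    by_cases hi : i = i₀
    · rw [if_pos hi, hi]; simp [shape]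
    · rw [if_neg hi]
      refine hB _ (Λs.sub_mem (hα.mem x hxc i) (hα.mem x hxc i₀)) ?_
      have h0i : i ∈ Finset.Ioi i₀ := Finset.mem_Ioi.2
        (lt_of_le_of_ne (Fin.mk_le_of_le_val (Nat.zero_le _)) (Ne.symm hi))
      have h1 : sqNorm (α x i₀ - α x i) ≤ spsd (α x) :=
        (Finset.single_le_sum (f := fun j => sqNorm (α x i₀ - α x j))
          (fun _ _ => sqNorm_nonneg _) h0i).trans
        (Finset.single_le_sum (f := fun i => ∑ j ∈ Finset.Ioi i, sqNorm (α x i - α x j))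
          (fun _ _ => Finset.sum_nonneg fun _ _ => sqNorm_nonneg _) (Finset.mem_univ i₀))
      have h2 := h1.trans hxR
      rw [sqNorm_eq, norm_sub_rev, div_le_div_iff_of_pos_right hL'] at h2
      exact (sq_le_sq₀ (norm_nonneg _) hR).1 h2
  have hW : W.card ≤ N * P.card := by
    rw [Finset.card_eq_sum_card_fiberwise hWP, mul_comm]
    refine Finset.sum_le_card_nsmul _ _ _ fun S _ => ?_
    refine (Finset.card_le_card (Finset.filter_subset_filter _ (Finset.filter_subset _ V))).trans ?_
    exact hsp ▸ card_filter_shape_le hps hsc (by omega) hV hα i₀ S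
  -- Few shapes, each of multiplicity at most N: at most half of the N² points have small SPSD.
  have hWr : (W.card : ℝ) ≤ (N : ℝ) ^ 2 / 2 := by
    have h1 : (W.card : ℝ) ≤ N * (B.card : ℝ) ^ (K - 1) := by
      rw [hP] at hW; exact_mod_cast hW
    have hN' : (0 : ℝ) < N := by exact_mod_cast hN
    nlinarith
  have hVW : ((V \ W).card : ℝ) = (N : ℝ) ^ 2 - W.card := by
    rw [Finset.cast_card_sdiff (Finset.filter_subset _ V), hcard]
    push_cast
    ring
  calc (N : ℝ) ^ 2 / 2 * (R ^ 2 / L) ≤ (V \ W).card * (R ^ 2 / L) := by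
        gcongr
        linarith
    _ = ∑ _x ∈ V \ W, R ^ 2 / L := by rw [Finset.sum_const, nsmul_eq_mul]
    _ ≤ ∑ x ∈ V \ W, spsd (α x) := by
        refine Finset.sum_le_sum fun x hx => ?_
        rw [Finset.mem_sdiff, Finset.mem_filter, not_and] at hx
        exact (not_le.1 (hx.2 hx.1)).le
    _ ≤ ∑ x ∈ V, spsd (α x) :=
        Finset.sum_le_sum_of_subset_of_nonneg Finset.sdiff_subset fun x _ _ => spsd_nonneg _

/-! ### The central distortion -/

lemma centralDistortion_nonneg {L : ℕ} (Λ : Submodule ℤ (E L)) : 0 ≤ centralDistortion Λ := by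
  have h : 0 ≤ ZLattice.covolume Λ volume := ENNReal.toReal_nonneg
  have h2 : 0 ≤ ∫ x in voronoiCell Λ 0, sqNorm x := integral_nonneg fun x => sqNorm_nonneg x
  unfold centralDistortion normalizedSecondMoment
  positivity

/-- The Voronoi cell lies in the ball of radius `r`, and the powers of the covolume in the
definition reduce to a single division by it. -/
lemma centralDistortion_le {L : ℕ} (hL : 0 < L) {Λ : Submodule ℤ (E L)} {r : ℝ} (hr : 0 ≤ r)
    (hv : 0 < ZLattice.covolume Λ volume) (h : ∀ x, ∃ v ∈ Λ, ‖x - v‖ ≤ r) :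
    centralDistortion Λ ≤ r ^ 2 / L *
      (r ^ L * volume.real (Metric.closedBall (0 : E L) 1)) / ZLattice.covolume Λ volume := by
  have hL' : (0 : ℝ) < L := by exact_mod_cast hL
  have hsub : voronoiCell Λ 0 ⊆ Metric.closedBall (0 : E L) r := by
    intro x hx
    obtain ⟨w, hw, hxw⟩ := h x
    have h1 := hx w hw
    rw [sqNorm_eq, sqNorm_eq, sub_zero, div_le_div_iff_of_pos_right hL',
      sq_le_sq₀ (norm_nonneg _) (norm_nonneg _)] at h1
    rw [mem_closedBall_zero_iff]
    exact h1.trans hxw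
  have hfin : volume (Metric.closedBall (0 : E L) r) < ⊤ := measure_closedBall_lt_top
  have hint : ∫ x in voronoiCell Λ 0, sqNorm x
      ≤ r ^ 2 / L * (r ^ L * volume.real (Metric.closedBall (0 : E L) 1)) := by
    have h1 := norm_setIntegral_le_of_norm_le_const (μ := volume) (f := fun x : E L => sqNorm x)
      (C := r ^ 2 / L) ((measure_mono hsub).trans_lt hfin) (fun x hx => by
        rw [Real.norm_of_nonneg (sqNorm_nonneg x), sqNorm_eq]
        have := mem_closedBall_zero_iff.1 (hsub hx)
        gcongr)
    refine (le_abs_self _).trans (h1.trans ?_)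
    have h2 : volume.real (voronoiCell Λ 0) ≤ volume.real (Metric.closedBall (0 : E L) r) :=
      measureReal_mono hsub hfin.ne
    rw [Measure.addHaar_real_closedBall' _ _ hr, finrank_euclideanSpace, Fintype.card_fin] at h2
    gcongr
  have heq : centralDistortion Λ
      = (∫ x in voronoiCell Λ 0, sqNorm x) / ZLattice.covolume Λ volume := by
    rw [centralDistortion, normalizedSecondMoment, Real.rpow_add hv, Real.rpow_one]
    have : ZLattice.covolume Λ volume ^ (2 / (L : ℝ)) ≠ 0 := (Real.rpow_pos_of_pos hv _).ne'
    field_simp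
  rw [heq]
  gcongr

/-! ### Uniform bounds and the limits -/

/-- The competitor has no larger SPSD sum. Under cost optimality the SPSD terms can then be dropped;
under SPSD optimality the two SPSD sums coincide and the secondary criterion applies. -/
lemma OptimalQuantizer.centroidSum_le {L K : ℕ} {Λ : Submodule ℤ (E L)} (hK : 2 ≤ K)
    (Q : OptimalQuantizer Λ K) {r : ℝ} (hr : ∀ x, ∃ v ∈ Q.Λs, ‖x - v‖ ≤ r) :
    centroidSum Q.V Q.α ≤ (Q.N : ℝ) ^ 2 * ((2 * r) ^ 2 / L) := by
  obtain ⟨β, hβ, hspsd, hcent⟩ := exists_labeling_spsdSum_le (by omega) Q.N_pos Q.product_le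
    Q.side_le Q.side_index Q.product_index Q.isVoronoiLabelSet Q.isLabeling hr
  refine le_trans ?_ hcent
  rcases Q.optimal with h | h
  · obtain ⟨A, B, hA, hB, hcost⟩ := exists_cost_eq hK Q.N_pos Q.p_pos Q.p_lt_one L
    have := h β hβ
    rw [hcost, hcost] at this
    have h2 := mul_le_mul_of_nonneg_left hspsd hB
    exact le_of_mul_le_mul_left (by linarith) hA
  · exact (h β hβ).2 (le_antisymm hspsd (h β hβ).1)

/-- The bounds that are uniform over all quantizers of large index. -/
lemma OptimalQuantizer.exists_bounds (L K : ℕ) (hL : 1 ≤ L) (hK : 2 ≤ K) (Λ : Submodule ℤ (E L))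
    [DiscreteTopology Λ] [IsZLattice ℝ Λ] :
    ∃ (C : ℝ) (N₀ : ℕ), ∀ Q : OptimalQuantizer Λ K, N₀ ≤ Q.N →
      0 < spsdSum Q.V Q.α ∧
      centroidSum Q.V Q.α / spsdSum Q.V Q.α
        ≤ C * (Q.N : ℝ) ^ (-(2 / ((L : ℝ) * ((K : ℝ) - 1)))) ∧
      (Q.N : ℝ) ^ 2 * centralDistortion Q.Λc / spsdSum Q.V Q.α
        ≤ C * (Q.N : ℝ) ^ (-(2 / ((L : ℝ) * ((K : ℝ) - 1)))) := by
  obtain ⟨r, hr0, hr⟩ := exists_covering_radius Λ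
  obtain ⟨M, hM, hball⟩ := exists_card_ball_le Λ
  have hL' : (0 : ℝ) < L := by exact_mod_cast hL
  set D := L * (K - 1) with hD
  have hD0 : D ≠ 0 := Nat.mul_ne_zero (by omega) (by omega)
  have hDr : (D : ℝ) = (L : ℝ) * ((K : ℝ) - 1) := by
    rw [hD, Nat.cast_mul, Nat.cast_sub (by omega), Nat.cast_one]
  have hv := ZLattice.covolume_pos Λ volume
  set ν := ZLattice.covolume Λ volume
  set ω := volume.real (Metric.closedBall (0 : E L) 1)
  have hω : 0 ≤ ω := measureReal_nonneg
  set C₁ : ℝ := (2 * r) ^ 2 / L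
  set C₂ : ℝ := (1 / (8 * M)) ^ 2 / (2 * L)
  set C₃ : ℝ := r ^ 2 / L * (r ^ L * ω) / ν
  have hC₂ : 0 < C₂ := by positivity
  have hC₃ : 0 ≤ C₃ := by positivity
  -- The threshold `4 ^ D` ensures `4 ≤ t` below, so that `t / 4 + 1 ≤ t / 2` absorbs the additive 1
  -- of the ball count.
  refine ⟨max (C₁ / C₂) (C₃ / C₂), 4 ^ D, fun Q hQ => ?_⟩
  obtain ⟨c, hc, U, hU⟩ := Q.central_similar
  obtain ⟨s, hs, U', hU'⟩ := Q.side_similar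
  obtain ⟨_, _, hcov⟩ := isZLattice_and_covolume_of_similar hc hU
  obtain ⟨_, _, hcov'⟩ := isZLattice_and_covolume_of_similar hs hU'
  have hN : (0 : ℝ) < Q.N := by exact_mod_cast Q.N_pos
  -- The index is the ratio of covolumes, which fixes the similarity ratio of Λs.
  have hsN : s ^ L = Q.N := by
    have h1 := ZLattice.covolume_div_covolume_eq_relIndex' Q.Λs Q.Λc Q.side_le
    rw [hcov', mul_div_assoc, div_self (ZLattice.covolume_ne_zero Q.Λc volume), mul_one] at h1
    rw [h1]
    exact_mod_cast Q.side_index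
  have hs1 : 1 ≤ s := by
    by_contra hlt
    have : s ^ L < 1 := pow_lt_one₀ hs.le (not_le.1 hlt) (by omega)
    rw [hsN] at this
    have : (1 : ℝ) ≤ Q.N := by exact_mod_cast Q.N_pos
    linarith
  set t : ℝ := (Q.N : ℝ) ^ ((D : ℝ)⁻¹)
  have ht0 : 0 < t := Real.rpow_pos_of_pos hN _
  have htD : t ^ D = Q.N := Real.rpow_inv_natCast_pow hN.le hD0
  have ht4 : 4 ≤ t := by
    refine (pow_le_pow_iff_left₀ (by norm_num) ht0.le hD0).1 ?_
    rw [htD]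
    exact_mod_cast hQ
  have htN : (Q.N : ℝ) ^ (-(2 / ((L : ℝ) * ((K : ℝ) - 1)))) = (t ^ 2)⁻¹ := by
    rw [Real.rpow_neg hN.le, ← hDr, ← Real.rpow_mul_natCast hN.le]
    congr 2
    push_cast
    ring
  have hrc := exists_mem_near_of_similar hc hU hr
  have hrs := exists_mem_near_of_similar hs hU' hrc
  have hcent := Q.centroidSum_le hK hrs
  -- With radius `t / (8 * M)` before scaling, the ball holds at most `(t / 2) ^ L` points, and the
  -- power K - 1 of this is `N / 2 ^ D`, at most `N / 2`.
  obtain ⟨B, hB, hBcard⟩ := exists_card_ball_le_of_similar hs hU'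
    (exists_card_ball_le_of_similar hc hU (hball (t / (8 * M)) (by positivity)))
  have hBN : 2 * (B.card : ℝ) ^ (K - 1) ≤ Q.N := by
    have h1 : 2 * M * (t / (8 * M)) + 1 ≤ t / 2 := by
      have : 2 * M * (t / (8 * M)) = t / 4 := by field_simp; ring
      linarith
    have h2 : (B.card : ℝ) ^ (K - 1) ≤ (t / 2) ^ D := by
      rw [hD, pow_mul]
      gcongr
      exact hBcard.trans (by gcongr)
    rw [div_pow, htD] at h2
    have h3 : (2 : ℝ) ≤ 2 ^ D := le_self_pow₀ (by norm_num) hD0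
    have h4 : (Q.N : ℝ) / 2 ^ D ≤ Q.N / 2 := by gcongr
    linarith
  have hspsd := le_spsdSum (by omega) Q.N_pos Q.product_le Q.side_le Q.side_index
    Q.product_index Q.isVoronoiLabelSet Q.isLabeling (by positivity) B hB hBN
  have hdist := centralDistortion_le hL (by positivity) (hcov ▸ by positivity) hrc
  rw [hcov] at hdist
  change _ ≤ (c * r) ^ 2 / L * ((c * r) ^ L * ω) / (c ^ L * ν) at hdist
  set S := spsdSum Q.V Q.α
  have hS : C₂ * ((Q.N : ℝ) ^ 2 * (s * c) ^ 2 * t ^ 2) ≤ S := by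
    refine le_trans (le_of_eq ?_) hspsd
    simp only [C₂]
    field_simp
  have hlow : 0 < C₂ * ((Q.N : ℝ) ^ 2 * (s * c) ^ 2 * t ^ 2) := by positivity
  have hcent' : centroidSum Q.V Q.α ≤ C₁ * ((Q.N : ℝ) ^ 2 * (s * c) ^ 2) := by
    refine hcent.trans (le_of_eq ?_)
    simp only [C₁]
    ring
  have hdist' : (Q.N : ℝ) ^ 2 * centralDistortion Q.Λc ≤ C₃ * ((Q.N : ℝ) ^ 2 * (s * c) ^ 2) := by
    have h1 : centralDistortion Q.Λc ≤ C₃ * c ^ 2 := by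
      refine hdist.trans (le_of_eq ?_)
      simp only [C₃, mul_pow]
      field_simp
    have h2 : c ^ 2 ≤ (s * c) ^ 2 := by
      gcongr
      exact le_mul_of_one_le_left hc.le hs1
    calc (Q.N : ℝ) ^ 2 * centralDistortion Q.Λc ≤ (Q.N : ℝ) ^ 2 * (C₃ * (s * c) ^ 2) := by
          gcongr
          exact h1.trans (by gcongr)
      _ = _ := by ring
  -- The scale factor `(s * c) ^ 2` cancels, so the constants depend only on Λ, L and K.
  have key (a C' : ℝ) (hC' : 0 ≤ C') (ha : a ≤ C' * ((Q.N : ℝ) ^ 2 * (s * c) ^ 2)) :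
      a / S ≤ C' / C₂ * (t ^ 2)⁻¹ := by
    calc a / S ≤ C' * ((Q.N : ℝ) ^ 2 * (s * c) ^ 2)
          / (C₂ * ((Q.N : ℝ) ^ 2 * (s * c) ^ 2 * t ^ 2)) := by gcongr
      _ = _ := by field_simp
  rw [htN]
  refine ⟨hlow.trans_le hS, (key _ C₁ (by positivity) hcent').trans ?_,
    (key _ C₃ hC₃ hdist').trans ?_⟩
  · gcongr; exact le_max_left _ _
  · gcongr; exact le_max_right _ _

end MDLVQ

theorem proposition1 (L K : ℕ) (hL : 1 ≤ L) (hK : 2 ≤ K)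
    (Λ : Submodule ℤ (MDLVQ.E L)) [DiscreteTopology Λ] [IsZLattice ℝ Λ] :
    (∀ᶠ Q in MDLVQ.OptimalQuantizer.highResolution Λ K, 0 < MDLVQ.spsdSum Q.V Q.α) ∧
    Tendsto (fun Q => MDLVQ.centroidSum Q.V Q.α / MDLVQ.spsdSum Q.V Q.α)
      (MDLVQ.OptimalQuantizer.highResolution Λ K) (𝓝 0) ∧
    (fun Q => MDLVQ.centroidSum Q.V Q.α / MDLVQ.spsdSum Q.V Q.α)
      =O[MDLVQ.OptimalQuantizer.highResolution Λ K]
        (fun Q => (Q.N : ℝ) ^ (-(2 / ((L : ℝ) * ((K : ℝ) - 1))))) ∧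
    (∀ κ : ℕ, 1 ≤ κ → κ < K →
      Tendsto (fun Q => Q.pairwiseDistortion κ / Q.expectedDistortion κ)
        (MDLVQ.OptimalQuantizer.highResolution Λ K) (𝓝 1)) := by
  obtain ⟨C, N₀, hbound⟩ := MDLVQ.OptimalQuantizer.exists_bounds L K hL hK Λ
  have hev : ∀ᶠ Q in MDLVQ.OptimalQuantizer.highResolution Λ K, N₀ ≤ Q.N :=
    tendsto_comap.eventually (eventually_ge_atTop N₀)
  have hK1 : (0 : ℝ) < (K : ℝ) - 1 := by
    have : (2 : ℝ) ≤ K := by exact_mod_cast hK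
    linarith
  have hL0 : (0 : ℝ) < L := by exact_mod_cast hL
  have hpow : Tendsto (fun Q : MDLVQ.OptimalQuantizer Λ K =>
      (Q.N : ℝ) ^ (-(2 / ((L : ℝ) * ((K : ℝ) - 1)))))
      (MDLVQ.OptimalQuantizer.highResolution Λ K) (𝓝 0) :=
    (tendsto_rpow_neg_atTop (by positivity)).comp
      (tendsto_natCast_atTop_atTop.comp tendsto_comap)
  have hcent : (fun Q : MDLVQ.OptimalQuantizer Λ K =>
      MDLVQ.centroidSum Q.V Q.α / MDLVQ.spsdSum Q.V Q.α)
      =O[MDLVQ.OptimalQuantizer.highResolution Λ K]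
        (fun Q => (Q.N : ℝ) ^ (-(2 / ((L : ℝ) * ((K : ℝ) - 1))))) := by
    refine IsBigO.of_bound C ?_
    filter_upwards [hev] with Q hQ
    obtain ⟨h1, h2, -⟩ := hbound Q hQ
    rw [Real.norm_of_nonneg (div_nonneg (MDLVQ.centroidSum_nonneg _ _) h1.le),
      Real.norm_of_nonneg (by positivity)]
    exact h2
  have hdist : (fun Q : MDLVQ.OptimalQuantizer Λ K =>
      (Q.N : ℝ) ^ 2 * MDLVQ.centralDistortion Q.Λc / MDLVQ.spsdSum Q.V Q.α)
      =O[MDLVQ.OptimalQuantizer.highResolution Λ K]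
        (fun Q => (Q.N : ℝ) ^ (-(2 / ((L : ℝ) * ((K : ℝ) - 1))))) := by
    refine IsBigO.of_bound C ?_
    filter_upwards [hev] with Q hQ
    obtain ⟨h1, -, h3⟩ := hbound Q hQ
    rw [Real.norm_of_nonneg (div_nonneg (mul_nonneg (by positivity)
      (MDLVQ.centralDistortion_nonneg _)) h1.le), Real.norm_of_nonneg (by positivity)]
    exact h3
  have hcent0 := hcent.trans_tendsto hpow
  have hdist0 := hdist.trans_tendsto hpow
  refine ⟨hev.mono fun Q hQ => (hbound Q hQ).1, hcent0, hcent, fun κ hκ hκK => ?_⟩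
  set g : ℝ := ((K : ℝ) - κ) / ((K : ℝ) ^ 2 * κ * ((K : ℝ) - 1)) with hg
  have hg0 : 0 < g := by
    have h1 : (κ : ℝ) < K := by exact_mod_cast hκK
    have h2 : (0 : ℝ) < κ := by exact_mod_cast hκ
    have h3 : (0 : ℝ) < K := h2.trans h1
    exact div_pos (sub_pos.2 h1) (by positivity)
  -- The weight in `p` and the binomial coefficient cancel in the ratio, whose reciprocal is 1 plus
  -- the two vanishing ratios divided by `g`.
  have hlim := (((hdist0.add hcent0).div_const g).const_add 1).inv₀ (by simp)
  simp only [add_zero, zero_div, inv_one] at hlim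
  refine hlim.congr' ?_
  filter_upwards [hev] with Q hQ
  obtain ⟨hS, -, -⟩ := hbound Q hQ
  have hN : (0 : ℝ) < Q.N := by exact_mod_cast Q.N_pos
  have hp := Q.p_pos
  have hp1 := sub_pos.2 Q.p_lt_one
  have hch : (0 : ℝ) < K.choose κ := by exact_mod_cast Nat.choose_pos hκK.le
  have hd := MDLVQ.centralDistortion_nonneg Q.Λc
  have hc := MDLVQ.centroidSum_nonneg Q.V Q.α
  rw [MDLVQ.OptimalQuantizer.pairwiseDistortion, MDLVQ.OptimalQuantizer.expectedDistortion,
    MDLVQ.receptionSum_eq hK hκ hκK, ← hg]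
  set S := MDLVQ.spsdSum Q.V Q.α
  set d := MDLVQ.centralDistortion Q.Λc
  set e := MDLVQ.centroidSum Q.V Q.α
  have hw : 0 < (1 - Q.p) ^ κ * Q.p ^ (K - κ) := by positivity
  set w := (1 - Q.p) ^ κ * Q.p ^ (K - κ)
  have h1 : 0 < g * S + ((Q.N : ℝ) ^ 2 * d + e) := by positivity
  have h2 : 1 + ((Q.N : ℝ) ^ 2 * d / S + e / S) / g
      = (g * S + ((Q.N : ℝ) ^ 2 * d + e)) / (g * S) := by
    field_simp
  have h3 : w * ((K.choose κ : ℝ) * d + 1 / (Q.N : ℝ) ^ 2 * ((K.choose κ : ℝ) * (e + g * S)))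
      = w * K.choose κ * (1 / (Q.N : ℝ) ^ 2) * (g * S + ((Q.N : ℝ) ^ 2 * d + e)) := by
    field_simp
    ring
  rw [h2, h3, inv_div]
  field_simp
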